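/- **Proposition 2 (powers of Gaussian variables).** Let $G$ be a standard Gaussian random variable, let $p>0$, set $Z=\operatorname{sign}(G)|G|^p$, let $(Z_i)_{i\ge 1}$ be independent random variables with the same law as $Z$, and let $S_n=\frac1n\sum_{i=1}^n Z_i$. (i) If $p\in(0,2]$, then $(S_n)_{n\ge1}$ satisfies a large deviations principle at speed $n$ with rate function $$J(x)=\sup_{\eta\in\mathbb R}\{\eta x-\lambda(\eta)\},\qquad \lambda(\eta)=\log\mathbb E\big[e^{\eta Z}\big]\in(-\infty,+\infty].$$ (ii) If $p>2$, then $(S_n)_{n\ge1}$ satisfies a large deviations principle at speed $n^{2/p}$ with rate function $$I_{2/p}(x)=\frac{|x|^{2/p}}{2}.$$ Here $(S_n)$ satisfies a large deviations principle at speed $v_n$ with rate function $I:\mathbb R\to[0,+\infty]$ if $I$ is lower semicontinuous and, for every Borel set $B\subset\mathbb R$, $$-\inf_{\mathring B} I\le\liminf_{n\to\infty}\frac1{v_n}\log\mathbb P(S_n\in B)\le\limsup_{n\to\infty}\frac1{v_n}\log\mathbb P(S_n\in B)\le-\inf_{\overline B} I,$$ where $\mathring B$ and $\overline B$ are the interior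 and the closure of $B$, $\log 0=-\infty$ and $\inf_\emptyset I=+\infty$. -/

import Mathlib

open MeasureTheory ProbabilityTheory Filter Topology
open scoped ENNReal

noncomputable section

/-- The signed power `sign(x) |x|^p`. -/
def signedPow (p x : ℝ) : ℝ := Real.sign x * |x| ^ p

/-- The empirical mean `(1/n) ∑_{i<n} X_i` of the first `n` samples. -/
def empiricalMean {Ω : Type*} (X : ℕ → Ω → ℝ) (n : ℕ) (ω : Ω) : ℝ :=
  (1 / (n : ℝ)) * ∑ i ∈ Finset.range n, X i ω

/-- The free energy `log E[exp (η X)]`, valued in the extended reals: it is `⊤` exactly when the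
exponential moment is infinite. -/
def freeEnergy {Ω : Type*} [MeasurableSpace Ω] (P : Measure Ω) (X : Ω → ℝ) (η : ℝ) : EReal :=
  ENNReal.log (∫⁻ ω, ENNReal.ofReal (Real.exp (η * X ω)) ∂P)

/-- The Legendre transform `sup_η (η x - Λ(η))` of an extended-real valued function. -/
def legendreTransform (Λ : ℝ → EReal) (x : ℝ) : EReal :=
  ⨆ η : ℝ, (((η * x : ℝ) : EReal) - Λ η)

/-- Large deviations principle for the random variables `Y n` at speed `v n` with rate function
`I`. Here `ENNReal.log 0 = ⊥`, and an infimum over the empty set is `⊤`. -/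
structure SatisfiesLDP {Ω E : Type*} [MeasurableSpace Ω] [TopologicalSpace E] [MeasurableSpace E]
    [BorelSpace E] (P : Measure Ω) (Y : ℕ → Ω → E) (v : ℕ → ℝ) (I : E → EReal) : Prop where
  nonneg : ∀ x, 0 ≤ I x
  lowerSemicontinuous : LowerSemicontinuous I
  lower_bound : ∀ B : Set E, MeasurableSet B →
    -(⨅ x ∈ interior B, I x) ≤
      liminf (fun n : ℕ => ENNReal.log (P {ω | Y n ω ∈ B}) / (v n : EReal)) atTop
  upper_bound : ∀ B : Set E, MeasurableSet B →
    limsup (fun n : ℕ => ENNReal.log (P {ω | Y n ω ∈ B}) / (v n : EReal)) atTop ≤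
      -(⨅ x ∈ closure B, I x)

end

/-! The law of `Z` is symmetric, so it suffices to bound P(|S_n| ≥ a) from above and the probability
of small balls from below (`satisfiesLDP_of_eventually_bounds`): the upper bound for a Borel set
only involves the point of its closure nearest to 0.

For p ≤ 2 this is Cramér's theorem (`satisfiesLDP_legendreTransform`). The upper bound is
Chernoff's. For the lower bound at x, the moment generating function m of `Z - x` attains its
minimum because `Z` is unbounded on both sides, and at an interior point because it is finite
exactly on an open set: all of ℝ if p < 2, and (-1/2, 1/2) if p = 2. At the minimiser η one has
m'(η) = 0, so in m(η)^n = E[exp(ηT)], with T the centred sum, the part where |T| ≥ nδ is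
exponentially negligible: it is at most (m(η ± h) exp(-hδ))^n, and m(η ± h) exp(-hδ) < m(η) for
small h. The rest forces |T| < nδ with probability about m(η)^n.

For p > 2, put α = 2/p < 1. Then |Z|^α = G^2 and `Z` has tail exp(-x^α/2), so a single large jump is
the cheapest way to move the mean (`satisfiesLDP_abs_rpow_div_two`). From above, either some summand
reaches na, or the sum truncated at na does; a tilt of order n^(α-1) shows that truncated sums give
no better rate. From below, one summand is placed near nx and Chebyshev's inequality controls the
others. -/

theorem ENNReal.log_ofReal_exp (x : ℝ) :
    ENNReal.log (ENNReal.ofReal (Real.exp x)) = (x : EReal) := by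
  rw [ENNReal.log_ofReal_of_pos (Real.exp_pos x), Real.log_exp]

/-- A real-valued sequence satisfies a large deviations principle with even rate function as soon
as one has exponential upper bounds for `|Y n| ≥ a` and exponential lower bounds on balls. -/
theorem satisfiesLDP_of_eventually_bounds {Ω : Type*} [MeasurableSpace Ω] {P : Measure Ω}
    [IsProbabilityMeasure P] {Y : ℕ → Ω → ℝ} {v : ℕ → ℝ} {I : ℝ → EReal}
    (hv : ∀ᶠ n in atTop, 0 < v n) (hI : ∀ x, 0 ≤ I x) (hI_lsc : LowerSemicontinuous I)
    (hI_abs : ∀ x, I |x| = I x)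
    (h_upper : ∀ a : ℝ, 0 ≤ a → ∀ c : ℝ, (c : EReal) < I a →
      ∀ᶠ n in atTop, P.real {ω | a ≤ |Y n ω|} ≤ Real.exp (-c * v n))
    (h_lower : ∀ x δ : ℝ, 0 < δ → ∀ c : ℝ, I x < (c : EReal) →
      ∀ᶠ n in atTop, Real.exp (-c * v n) ≤ P.real {ω | |Y n ω - x| < δ}) :
    SatisfiesLDP P Y v I where
  nonneg := hI
  lowerSemicontinuous := hI_lsc
  lower_bound := by
    intro B _
    rw [EReal.neg_le]
    refine le_iInf₂ fun x hx => ?_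
    rw [EReal.neg_le]
    refine EReal.ge_of_forall_gt_iff_ge.mp fun b hb => ?_
    obtain ⟨δ, hδ, hB⟩ := Metric.isOpen_iff.mp isOpen_interior x hx
    have hc : I x < ((-b : ℝ) : EReal) := by
      rw [EReal.coe_neg]; exact EReal.lt_neg_comm.mp hb
    refine le_liminf_of_le (by isBoundedDefault) ?_
    filter_upwards [hv, h_lower x δ hδ (-b) hc] with n hn h
    rw [EReal.le_div_iff_mul_le (by exact_mod_cast hn) (EReal.coe_ne_top _)]
    rw [← EReal.coe_mul, ← ENNReal.log_ofReal_exp]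
    refine ENNReal.log_le_log ?_
    refine (ENNReal.ofReal_le_ofReal ((by simpa using h :
      Real.exp (b * v n) ≤ _))).trans ?_
    rw [ofReal_measureReal]
    refine measure_mono fun ω hω => ?_
    exact interior_subset (s := B) (hB (by simpa [Real.dist_eq] using hω))
  upper_bound := by
    intro B _
    rcases B.eq_empty_or_nonempty with rfl | hB
    · simp only [Set.mem_empty_iff_false, Set.ofPred_false, measure_empty, ENNReal.log_zero,
        closure_empty, iInf_false, iInf_top, EReal.neg_top]
      refine limsup_le_of_le (by isBoundedDefault) ?_
      filter_upwards [hv] with n hn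
      rw [EReal.bot_div_of_pos_ne_top (by exact_mod_cast hn) (EReal.coe_ne_top _)]
    -- Choose a point of the closure nearest to 0: `B` then lies in {|z| ≥ |y|}, and `I y` already
    -- dominates the infimum over the closure.
    obtain ⟨y, hy, hyd⟩ := isClosed_closure.exists_infDist_eq_dist hB.closure (0 : ℝ)
    have hmin : ∀ z ∈ B, |y| ≤ |z| := by
      intro z hz
      have := Metric.infDist_le_dist_of_mem (x := (0 : ℝ)) (subset_closure hz)
      rw [hyd] at this
      simpa [Real.dist_eq] using this
    refine le_trans ?_ (EReal.neg_le_neg_iff.mpr (iInf₂_le y hy))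
    refine EReal.le_of_forall_lt_iff_le.mp fun b hb => ?_
    have hc : ((-b : ℝ) : EReal) < I |y| := by
      rw [EReal.coe_neg, hI_abs]; exact EReal.neg_lt_comm.mp hb
    refine limsup_le_of_le (by isBoundedDefault) ?_
    filter_upwards [hv, h_upper |y| (abs_nonneg y) (-b) hc] with n hn h
    rw [EReal.div_le_iff_le_mul (by exact_mod_cast hn) (EReal.coe_ne_top _)]
    rw [← EReal.coe_mul, ← ENNReal.log_ofReal_exp]
    refine ENNReal.log_le_log ?_
    refine le_trans ?_ (ENNReal.ofReal_le_ofReal ((by simpa [mul_comm] using h :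
      _ ≤ Real.exp (v n * b))))
    rw [ofReal_measureReal]
    exact measure_mono fun ω hω => hmin _ hω

/-! ### Free energy and Legendre transform -/

section FreeEnergy

variable {Ω : Type*} [MeasurableSpace Ω] {P : Measure Ω} {X : Ω → ℝ} {η : ℝ}

theorem freeEnergy_eq_cgf [NeZero P] (h : Integrable (fun ω => Real.exp (η * X ω)) P) :
    freeEnergy P X η = (cgf X P η : EReal) := by
  rw [freeEnergy,
    ← ofReal_integral_eq_lintegral_ofReal h (ae_of_all _ fun _ => (Real.exp_pos _).le)]
  exact ENNReal.log_ofReal_of_pos (mgf_pos_iff.mpr h)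

theorem integrable_of_freeEnergy_ne_top (hX : AEMeasurable X P) (h : freeEnergy P X η ≠ ⊤) :
    Integrable (fun ω => Real.exp (η * X ω)) P := by
  rw [freeEnergy, Ne, ENNReal.log_eq_top_iff] at h
  exact (lintegral_ofReal_ne_top_iff_integrable (by fun_prop)
    (ae_of_all _ fun _ => (Real.exp_pos _).le)).mp h

theorem freeEnergy_zero [IsProbabilityMeasure P] : freeEnergy P X 0 = 0 := by
  simp [freeEnergy]

theorem freeEnergy_congr_identDistrib {Ω' : Type*} [MeasurableSpace Ω'] {P' : Measure Ω'}
    {Y : Ω' → ℝ} (h : IdentDistrib X Y P P') : freeEnergy P X = freeEnergy P' Y := by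
  funext η
  have hu : Measurable fun x : ℝ => ENNReal.ofReal (Real.exp (η * x)) := by fun_prop
  exact congrArg ENNReal.log (h.comp hu).lintegral_eq

theorem freeEnergy_neg (h : IdentDistrib X (fun ω => -X ω) P P) (η : ℝ) :
    freeEnergy P X (-η) = freeEnergy P X η := by
  conv_rhs => rw [freeEnergy_congr_identDistrib h]
  simp [freeEnergy]

theorem freeEnergy_ne_bot [NeZero P] (hX : AEMeasurable X P) : freeEnergy P X η ≠ ⊥ := by
  by_cases h : freeEnergy P X η = ⊤
  · simp [h]
  · rw [freeEnergy_eq_cgf (integrable_of_freeEnergy_ne_top hX h)]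
    exact EReal.coe_ne_bot _

theorem legendreTransform_nonneg {Λ : ℝ → EReal} (h : Λ 0 = 0) (x : ℝ) :
    0 ≤ legendreTransform Λ x := by
  refine le_trans ?_ (le_iSup _ (0 : ℝ))
  simp [h]

/-- A supremum of continuous functions of x: each term is affine, or constantly `⊥` where `Λ η = ⊤`.
-/
theorem lowerSemicontinuous_legendreTransform {Λ : ℝ → EReal} (h : ∀ η, Λ η ≠ ⊥) :
    LowerSemicontinuous (legendreTransform Λ) := by
  refine lowerSemicontinuous_iSup fun η => Continuous.lowerSemicontinuous ?_
  induction hη : Λ η using EReal.rec with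
  | bot => exact absurd hη (h η)
  | top => simpa using continuous_const
  | coe r =>
    simp_rw [← EReal.coe_sub]
    exact continuous_coe_real_ereal.comp (by fun_prop)

theorem legendreTransform_neg {Λ : ℝ → EReal} (h : ∀ η, Λ (-η) = Λ η) (x : ℝ) :
    legendreTransform Λ (-x) = legendreTransform Λ x := by
  refine (Equiv.neg ℝ).iSup_congr fun η => ?_
  simp [h]

theorem legendreTransform_abs {Λ : ℝ → EReal} (h : ∀ η, Λ (-η) = Λ η) (x : ℝ) :
    legendreTransform Λ |x| = legendreTransform Λ x := by
  rcases abs_choice x with hx | hx <;> rw [hx]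
  exact legendreTransform_neg h x

end FreeEnergy

/-! ### Exponential bounds for sums of independent variables -/

section Sums

theorem le_abs_empiricalMean_iff {Ω : Type*} {X : ℕ → Ω → ℝ} {n : ℕ} (hn : 0 < n)
    {a : ℝ} {ω : Ω} :
    a ≤ |empiricalMean X n ω| ↔ n * a ≤ |∑ i ∈ Finset.range n, X i ω| := by
  have hn' : (0 : ℝ) < n := by exact_mod_cast hn
  rw [empiricalMean, abs_mul, abs_of_pos (one_div_pos.mpr hn'), one_div, inv_mul_eq_div,
    le_div_iff₀ hn', mul_comm]

theorem abs_empiricalMean_sub_lt_iff {Ω : Type*} {X : ℕ → Ω → ℝ} {n : ℕ} (hn : 0 < n)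
    {x δ : ℝ} {ω : Ω} :
    |empiricalMean X n ω - x| < δ ↔ |∑ i ∈ Finset.range n, X i ω - n * x| < n * δ := by
  have hn' : (0 : ℝ) < n := by exact_mod_cast hn
  have : empiricalMean X n ω - x = (∑ i ∈ Finset.range n, X i ω - n * x) / n := by
    rw [empiricalMean]; field_simp
  rw [this, abs_div, abs_of_pos hn', div_lt_iff₀ hn', mul_comm δ]

variable {Ω : Type*} [MeasurableSpace Ω] {P : Measure Ω} {X : ℕ → Ω → ℝ}

theorem mgf_sum_range_eq_pow (hX : iIndepFun X P) (hid : ∀ i, IdentDistrib (X i) (X 0) P P)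
    (t : ℝ) (n : ℕ) :
    mgf (fun ω => ∑ i ∈ Finset.range n, X i ω) P t = mgf (X 0) P t ^ n := by
  have h := hX.mgf_sum₀ (t := t) (fun i => (hid i).aemeasurable_fst) (Finset.range n)
  simp_rw [mgf_congr_identDistrib (hid _)] at h
  rw [Finset.prod_const, Finset.card_range] at h
  rw [← h]
  congr 1
  ext ω
  simp

theorem integrable_exp_mul_sum_range [IsProbabilityMeasure P] (hX : iIndepFun X P)
    (hid : ∀ i, IdentDistrib (X i) (X 0) P P) {t : ℝ}
    (ht : Integrable (fun ω => Real.exp (t * X 0 ω)) P) (n : ℕ) :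
    Integrable (fun ω => Real.exp (t * ∑ i ∈ Finset.range n, X i ω)) P := by
  have h := mgf_sum_range_eq_pow hX hid t n
  -- The integral of a nonintegrable function is 0 by convention, so positivity of the `mgf` gives
  -- integrability.
  refine mgf_pos_iff.mp ?_
  rw [h]
  exact pow_pos (mgf_pos_iff.mpr ht) n

theorem iIndepFun_neg (hX : iIndepFun X P) : iIndepFun (fun i ω => -X i ω) P :=
  hX.comp (fun _ x => -x) (fun _ => measurable_neg)

/-- Chernoff bound for the sum of independent identically distributed variables. -/
theorem measureReal_le_sum_range_le [IsProbabilityMeasure P] (hX : iIndepFun X P)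
    (hid : ∀ i, IdentDistrib (X i) (X 0) P P) {t : ℝ} (ht0 : 0 ≤ t)
    (ht : Integrable (fun ω => Real.exp (t * X 0 ω)) P) (a : ℝ) (n : ℕ) :
    P.real {ω | a ≤ ∑ i ∈ Finset.range n, X i ω} ≤ Real.exp (-t * a) * mgf (X 0) P t ^ n := by
  rw [← mgf_sum_range_eq_pow hX hid]
  exact measure_ge_le_exp_mul_mgf a ht0 (integrable_exp_mul_sum_range hX hid ht n)

/-- Bounds on both tails of the sum yield a bound for the absolute value of the mean. -/
theorem measureReal_le_abs_empiricalMean_le [IsProbabilityMeasure P] {a b : ℝ} {n : ℕ} (hn : 0 < n)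
    (h₁ : P.real {ω | n * a ≤ ∑ i ∈ Finset.range n, X i ω} ≤ b)
    (h₂ : P.real {ω | n * a ≤ ∑ i ∈ Finset.range n, -X i ω} ≤ b) :
    P.real {ω | a ≤ |empiricalMean X n ω|} ≤ 2 * b := by
  calc P.real {ω | a ≤ |empiricalMean X n ω|}
      ≤ P.real ({ω | n * a ≤ ∑ i ∈ Finset.range n, X i ω} ∪
          {ω | n * a ≤ ∑ i ∈ Finset.range n, -X i ω}) := by
        refine measureReal_mono (fun ω hω => ?_) (measure_ne_top _ _)
        have := (le_abs_empiricalMean_iff hn).mp hω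
        rw [le_abs] at this
        simpa [Finset.sum_neg_distrib] using this
    _ ≤ _ := measureReal_union_le _ _
    _ ≤ 2 * b := by linarith

/-- Absorbs constant factors at the price of an arbitrarily small loss in the rate. -/
theorem eventually_mul_exp_le_exp {K b c : ℝ} (hbc : c < b) {v : ℕ → ℝ}
    (hv : Tendsto v atTop atTop) :
    ∀ᶠ n in atTop, K * Real.exp (-b * v n) ≤ Real.exp (-c * v n) := by
  have h : Tendsto (fun n => Real.exp ((b - c) * v n)) atTop atTop :=
    Real.tendsto_exp_atTop.comp (hv.const_mul_atTop (by linarith))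
  filter_upwards [h.eventually_ge_atTop K] with n hn
  calc K * Real.exp (-b * v n) ≤ Real.exp ((b - c) * v n) * Real.exp (-b * v n) := by gcongr
    _ = Real.exp (-c * v n) := by rw [← Real.exp_add]; ring_nf

theorem identDistrib_neg_zero (hid : ∀ i, IdentDistrib (X i) (X 0) P P)
    (i : ℕ) : IdentDistrib (fun ω => -X i ω) (fun ω => -X 0 ω) P P :=
  (hid i).comp measurable_neg

theorem eventually_measureReal_le_abs_empiricalMean [IsProbabilityMeasure P] (hX : iIndepFun X P)
    (hid : ∀ i, IdentDistrib (X i) (X 0) P P) (hsymm : IdentDistrib (X 0) (fun ω => -X 0 ω) P P)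
    {a c : ℝ} (ha : 0 ≤ a) (hc : (c : EReal) < legendreTransform (freeEnergy P (X 0)) a) :
    ∀ᶠ n : ℕ in atTop, P.real {ω | a ≤ |empiricalMean X n ω|} ≤ Real.exp (-c * n) := by
  obtain ⟨η₀, hη₀⟩ := lt_iSup_iff.mp hc
  -- Chernoff's bound needs a nonnegative tilt. The free energy is even and `a ≥ 0`, so reversing
  -- the sign of a negative tilt does not decrease the term.
  obtain ⟨η, hη0, hη⟩ : ∃ η : ℝ, 0 ≤ η ∧
      (c : EReal) < ((η * a : ℝ) : EReal) - freeEnergy P (X 0) η := by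
    rcases le_total 0 η₀ with h | h
    · exact ⟨η₀, h, hη₀⟩
    · refine ⟨-η₀, by linarith, hη₀.trans_le ?_⟩
      rw [freeEnergy_neg hsymm]
      refine EReal.sub_le_sub ?_ le_rfl
      exact_mod_cast (by nlinarith : η₀ * a ≤ -η₀ * a)
  have hint : Integrable (fun ω => Real.exp (η * X 0 ω)) P := by
    refine integrable_of_freeEnergy_ne_top hsymm.aemeasurable_fst fun h => ?_
    simp [h] at hη
  rw [freeEnergy_eq_cgf hint, ← EReal.coe_sub, EReal.coe_lt_coe_iff] at hη
  have key : ∀ Y : ℕ → Ω → ℝ, iIndepFun Y P → (∀ i, IdentDistrib (Y i) (Y 0) P P) →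
      IdentDistrib (X 0) (Y 0) P P → ∀ n : ℕ,
      P.real {ω | n * a ≤ ∑ i ∈ Finset.range n, Y i ω} ≤
        Real.exp (-(η * a - cgf (X 0) P η) * n) := by
    intro Y hY hYid hXY n
    have hu : Measurable fun x : ℝ => Real.exp (η * x) := by fun_prop
    have h := measureReal_le_sum_range_le hY hYid hη0 ((hXY.comp hu).integrable_snd hint) (n * a) n
    rw [← mgf_congr_identDistrib hXY, ← exp_cgf hint, ← Real.exp_nat_mul, ← Real.exp_add] at h
    refine h.trans_eq (congrArg Real.exp (by ring))
  filter_upwards [eventually_mul_exp_le_exp (K := 2) hη tendsto_natCast_atTop_atTop,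
    eventually_gt_atTop 0] with n hn hn0
  refine le_trans (measureReal_le_abs_empiricalMean_le hn0 (key X hX hid (hid 0) n) ?_) hn
  exact key _ (iIndepFun_neg hX) (identDistrib_neg_zero hid) hsymm n

/-- If the moment generating function of `Y` has a critical point, then the sums of independent
copies of `Y` stay near zero with probability at least its value to the power `n`. -/
theorem eventually_le_measureReal_abs_sum_lt [IsProbabilityMeasure P] (hX : iIndepFun X P)
    (hid : ∀ i, IdentDistrib (X i) (X 0) P P) {η : ℝ}
    (hη : η ∈ interior (integrableExpSet (X 0) P)) (hd : HasDerivAt (mgf (X 0) P) 0 η)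
    {δ c : ℝ} (hδ : 0 < δ) (hc : -cgf (X 0) P η < c) :
    ∀ᶠ n : ℕ in atTop, Real.exp (-c * n) ≤
      P.real {ω | |∑ i ∈ Finset.range n, X i ω| < n * δ} := by
  set m := mgf (X 0) P with hm
  have hηi : Integrable (fun ω => Real.exp (η * X 0 ω)) P :=
    interior_subset (s := integrableExpSet (X 0) P) hη
  have hmpos : 0 < m η := mgf_pos_iff.mpr hηi
  -- Replacing exp(ηT) by its bound on the ball costs `|η| * δ'` per summand; `δ'` is shrunk until
  -- this fits in the slack below `c`.
  obtain ⟨δ', hδ', hδδ, hslack⟩ : ∃ δ', 0 < δ' ∧ δ' ≤ δ ∧ -cgf (X 0) P η + |η| * δ' < c := by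
    have h : Tendsto (fun d : ℝ => -cgf (X 0) P η + |η| * d) (𝓝[>] 0)
        (𝓝 (-cgf (X 0) P η + |η| * 0)) :=
      (Continuous.tendsto (by fun_prop) 0).mono_left nhdsWithin_le_nhds
    have h1 := h.eventually (gt_mem_nhds (by simpa using hc))
    obtain ⟨d, hd1, hd2⟩ := (h1.and (Ioc_mem_nhdsGT hδ)).exists
    exact ⟨d, hd2.1, hd2.2, hd1⟩
  -- The first-order change of `m` vanishes at the critical point, so the derivative at h = 0 is
  -- that of the exponential factor, `-(δ' * m η) < 0`.
  have hsmall : ∀ s : ℝ, ∀ᶠ h in 𝓝[>] (0 : ℝ), m (η + s * h) * Real.exp (-h * δ') < m η := by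
    intro s
    have hd0 : HasDerivAt (fun h : ℝ => m (η + s * h) * Real.exp (-h * δ')) (-(δ' * m η)) 0 := by
      have h1 : HasDerivAt (fun h : ℝ => m (η + s * h)) (0 * (s * 1)) 0 := by
        have hin : HasDerivAt (fun h : ℝ => η + s * h) (s * 1) 0 :=
          ((hasDerivAt_id (0 : ℝ)).const_mul s).const_add η
        refine HasDerivAt.comp (0 : ℝ) (h₂ := m) ?_ hin
        simpa using hd
      have h2 : HasDerivAt (fun h : ℝ => Real.exp (-h * δ'))
          (Real.exp (-0 * δ') * (-1 * δ')) 0 :=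
        (((hasDerivAt_id (0 : ℝ)).neg).mul_const δ').exp
      exact (h1.mul h2).congr_deriv (by simp; ring)
    have hneg : -(δ' * m η) < 0 := by have := mul_pos hδ' hmpos; linarith
    have hev := (hasDerivWithinAt_iff_tendsto_slope' (by simp)).mp
      (hd0.hasDerivWithinAt (s := Set.Ioi 0)) |>.eventually (gt_mem_nhds hneg)
    filter_upwards [hev, self_mem_nhdsWithin] with h hh hpos
    rw [slope_def_field, div_neg_iff] at hh
    have hpos' : (0 : ℝ) < h := hpos
    rcases hh with hh | hh
    · linarith [hh.2]
    · have := hh.1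
      simp at this
      simpa using this
  have hint : ∀ s : ℝ, ∀ᶠ h in 𝓝[>] (0 : ℝ),
      Integrable (fun ω => Real.exp ((η + s * h) * X 0 ω)) P := by
    intro s
    have hcont : Tendsto (fun h : ℝ => η + s * h) (𝓝[>] 0) (𝓝 η) := by
      have : Tendsto (fun h : ℝ => η + s * h) (𝓝 0) (𝓝 (η + s * 0)) :=
        Continuous.tendsto (by fun_prop) 0
      rw [mul_zero, add_zero] at this
      exact this.mono_left nhdsWithin_le_nhds
    exact hcont.eventually (mem_interior_iff_mem_nhds.mp hη)
  obtain ⟨h, ⟨h1, h2⟩, ⟨h3, h4⟩, hpos⟩ := (((hsmall 1).and (hsmall (-1))).and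
    (((hint 1).and (hint (-1))).and self_mem_nhdsWithin)).exists
  have hpos' : (0 : ℝ) < h := hpos
  -- Split E[exp(ηT)] according to |T| < nδ', T ≥ nδ' and T ≤ -nδ'. On the last two events, exp(±hT
  -- - hnδ') ≥ 1 may be inserted, which moves the tilt to η ± h.
  have hmain : ∀ n : ℕ, m η ^ n ≤ Real.exp (|η| * (n * δ')) *
      P.real {ω | |∑ i ∈ Finset.range n, X i ω| < n * δ'} +
      ((m (η + 1 * h) * Real.exp (-h * δ')) ^ n + (m (η + -1 * h) * Real.exp (-h * δ')) ^ n) := by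
    intro n
    set T : Ω → ℝ := fun ω => ∑ i ∈ Finset.range n, X i ω with hT
    have hTm : AEMeasurable T P :=
      Finset.aemeasurable_fun_sum _ fun i _ => (hid i).aemeasurable_fst
    have hA : NullMeasurableSet {ω | |T ω| < n * δ'} P :=
      nullMeasurableSet_lt (by fun_prop) aemeasurable_const
    have e : ∀ s : ℝ, (m (η + s * h) * Real.exp (-h * δ')) ^ n =
        ∫ ω, Real.exp ((η + s * h) * T ω) * Real.exp (-h * (n * δ')) ∂P := by
      intro s
      rw [integral_mul_const, mul_pow, ← Real.exp_nat_mul]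
      congr 1
      · exact (mgf_sum_range_eq_pow hX hid _ n).symm
      · congr 1; ring
    have i0 : Integrable (fun ω => {ω | |T ω| < n * δ'}.indicator
        (fun _ => Real.exp (|η| * (n * δ'))) ω) P :=
      (integrable_const _).indicator₀ hA
    have i1 : Integrable (fun ω => Real.exp ((η + 1 * h) * T ω) * Real.exp (-h * (n * δ'))) P :=
       (integrable_exp_mul_sum_range hX hid h3 n).mul_const (Real.exp (-h * (n * δ')))
    have i2 : Integrable (fun ω => Real.exp ((η + -1 * h) * T ω) * Real.exp (-h * (n * δ'))) P :=
       (integrable_exp_mul_sum_range hX hid h4 n).mul_const (Real.exp (-h * (n * δ')))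
    have i3 : Integrable (fun ω => Real.exp ((η + 1 * h) * T ω) * Real.exp (-h * (n * δ')) +
        Real.exp ((η + -1 * h) * T ω) * Real.exp (-h * (n * δ'))) P := i1.add i2
    have e0 : Real.exp (|η| * (n * δ')) * P.real {ω | |T ω| < n * δ'} =
        ∫ ω, {ω | |T ω| < n * δ'}.indicator (fun _ => Real.exp (|η| * (n * δ'))) ω ∂P := by
      rw [integral_indicator₀ hA, setIntegral_const, smul_eq_mul, mul_comm]
    rw [e, e, e0, ← integral_add i1 i2, ← integral_add i0 i3,
      ← mgf_sum_range_eq_pow hX hid]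
    refine integral_mono (integrable_exp_mul_sum_range hX hid hηi n) (i0.add i3) fun ω => ?_
    change Real.exp (η * T ω) ≤ {ω | |T ω| < n * δ'}.indicator
      (fun _ => Real.exp (|η| * (n * δ'))) ω + (Real.exp ((η + 1 * h) * T ω) *
      Real.exp (-h * (n * δ')) + Real.exp ((η + -1 * h) * T ω) * Real.exp (-h * (n * δ')))
    rw [← Real.exp_add, ← Real.exp_add]
    by_cases hω : |T ω| < n * δ'
    · rw [Set.indicator_of_mem (by exact hω)]
      have : Real.exp (η * T ω) ≤ Real.exp (|η| * (n * δ')) := by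
        refine Real.exp_le_exp.mpr ((le_abs_self _).trans ?_)
        rw [abs_mul]
        gcongr
      have := Real.exp_pos ((η + 1 * h) * T ω + -h * (n * δ'))
      have := Real.exp_pos ((η + -1 * h) * T ω + -h * (n * δ'))
      linarith
    · rw [Set.indicator_of_notMem (by exact hω), zero_add]
      have p1 := Real.exp_pos ((η + 1 * h) * T ω + -h * (n * δ'))
      have p2 := Real.exp_pos ((η + -1 * h) * T ω + -h * (n * δ'))
      rcases le_abs.mp (not_lt.mp hω) with hT' | hT'
      · have : Real.exp (η * T ω) ≤ Real.exp ((η + 1 * h) * T ω + -h * (n * δ')) :=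
          Real.exp_le_exp.mpr (by nlinarith)
        linarith
      · have : Real.exp (η * T ω) ≤ Real.exp ((η + -1 * h) * T ω + -h * (n * δ')) :=
          Real.exp_le_exp.mpr (by nlinarith)
        linarith
  have hgeom : ∀ r : ℝ, 0 ≤ r → r < m η → Tendsto (fun n : ℕ => (r / m η) ^ n) atTop (𝓝 0) :=
    fun r hr hr' => tendsto_pow_atTop_nhds_zero_of_lt_one (by positivity)
      ((div_lt_one hmpos).mpr hr')
  -- Each outer part is eventually at most a quarter of `m η ^ n`, which leaves half for the ball.
  have g1 := (hgeom _ (by have := mgf_nonneg (X := X 0) (μ := P) (t := η + 1 * h); positivity)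
    h1).eventually (gt_mem_nhds (by norm_num : (0 : ℝ) < 1 / 4))
  have g2 := (hgeom _ (by have := mgf_nonneg (X := X 0) (μ := P) (t := η + -1 * h); positivity)
    h2).eventually (gt_mem_nhds (by norm_num : (0 : ℝ) < 1 / 4))
  filter_upwards [g1, g2, eventually_mul_exp_le_exp (K := 2) hslack tendsto_natCast_atTop_atTop]
    with n hn1 hn2 hn3
  rw [div_pow, div_lt_iff₀ (by positivity)] at hn1 hn2
  have hn := hmain n
  have hmono : P.real {ω | |∑ i ∈ Finset.range n, X i ω| < n * δ'} ≤
      P.real {ω | |∑ i ∈ Finset.range n, X i ω| < n * δ} := by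
    refine measureReal_mono (fun ω hω => ?_) (measure_ne_top _ _)
    simp only [Set.mem_ofPred_eq] at hω ⊢
    exact hω.trans_le (by gcongr)
  refine le_trans ?_ hmono
  set q := P.real {ω | |∑ i ∈ Finset.range n, X i ω| < n * δ'}
  have hmn : m η ^ n = Real.exp (cgf (X 0) P η * n) := by
    rw [hm, ← exp_cgf hηi, ← Real.exp_nat_mul, mul_comm]
  have hq : m η ^ n / 2 ≤ Real.exp (|η| * (n * δ')) * q := by linarith
  have hE : Real.exp (-(-cgf (X 0) P η + |η| * δ') * n) * Real.exp (|η| * (n * δ')) = m η ^ n := by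
    rw [hmn, ← Real.exp_add]; ring_nf
  refine le_of_mul_le_mul_right ?_ (Real.exp_pos (|η| * (n * δ')))
  have := mul_le_mul_of_nonneg_right hn3 (Real.exp_pos (|η| * (n * δ'))).le
  rw [hE] at this
  linarith

end Sums

/-! ### Critical tilts and Cramér's theorem -/

section Cramer

variable {Ω : Type*} [MeasurableSpace Ω] {P : Measure Ω}

/-- Fatou's lemma; the value `∞` is allowed, so finiteness need not be known beforehand. -/
theorem lowerSemicontinuous_lintegral_exp {Y : Ω → ℝ} (hY : AEMeasurable Y P) :
    LowerSemicontinuous fun η : ℝ => ∫⁻ ω, ENNReal.ofReal (Real.exp (η * Y ω)) ∂P := by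
  rw [lowerSemicontinuous_iff_le_liminf]
  intro η
  refine le_trans (le_of_eq ?_) (lintegral_liminf_le' fun t => by fun_prop)
  refine lintegral_congr fun ω => ?_
  have hc : Continuous fun t : ℝ => ENNReal.ofReal (Real.exp (t * Y ω)) :=
    ENNReal.continuous_ofReal.comp (by fun_prop)
  exact (hc.tendsto η).liminf_eq.symm

theorem exp_mul_measure_le_lintegral_exp {Y : Ω → ℝ} (hY : AEMeasurable Y P) {η : ℝ}
    (hη : 0 ≤ η) :
    ENNReal.ofReal (Real.exp η) * P {ω | 1 ≤ Y ω} ≤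
      ∫⁻ ω, ENNReal.ofReal (Real.exp (η * Y ω)) ∂P := by
  refine le_trans ?_ (mul_meas_ge_le_lintegral₀ (by fun_prop) (ENNReal.ofReal (Real.exp η)))
  gcongr with ω
  intro hω
  exact ENNReal.ofReal_le_ofReal (Real.exp_le_exp.mpr (by nlinarith))

/-- By Markov's inequality the moment is at least exp(η) P(Y ≥ 1). Since its value at 0 is 1, this
confines the search for a minimum to a compact interval. -/
theorem exists_forall_one_le_lintegral_exp [IsProbabilityMeasure P] {Y : Ω → ℝ}
    (hY : AEMeasurable Y P) (h : P {ω | 1 ≤ Y ω} ≠ 0) :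
    ∃ K : ℝ, 0 ≤ K ∧ ∀ η ≥ K, 1 ≤ ∫⁻ ω, ENNReal.ofReal (Real.exp (η * Y ω)) ∂P := by
  have hq : 0 < P.real {ω | 1 ≤ Y ω} := ENNReal.toReal_pos h (measure_ne_top _ _)
  obtain ⟨K, hK0, hK⟩ := ((eventually_ge_atTop (0 : ℝ)).and
    (Real.tendsto_exp_atTop.eventually_ge_atTop (P.real {ω | 1 ≤ Y ω})⁻¹)).exists
  refine ⟨K, hK0, fun η hη => le_trans ?_ (exp_mul_measure_le_lintegral_exp hY (hK0.trans hη))⟩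
  rw [← ofReal_measureReal (μ := P), ← ENNReal.ofReal_mul (Real.exp_pos _).le, ← ENNReal.ofReal_one]
  refine ENNReal.ofReal_le_ofReal ?_
  rw [← div_le_iff₀ hq, one_div]
  exact hK.trans (Real.exp_le_exp.mpr hη)

/-- If `Y` charges both sides of zero and its exponential moments are finite exactly on an open
set, then its moment generating function has a critical point. -/
theorem exists_hasDerivAt_mgf_zero [IsProbabilityMeasure P] {Y : Ω → ℝ} (hY : AEMeasurable Y P)
    (h₁ : P {ω | 1 ≤ Y ω} ≠ 0) (h₂ : P {ω | Y ω ≤ -1} ≠ 0)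
    (hopen : IsOpen (integrableExpSet Y P)) :
    ∃ η ∈ interior (integrableExpSet Y P), HasDerivAt (mgf Y P) 0 η := by
  -- The minimum is taken over the `ℝ≥0∞`-valued moment: the real `mgf` drops to 0 where the
  -- integral diverges.
  set M : ℝ → ℝ≥0∞ := fun η => ∫⁻ ω, ENNReal.ofReal (Real.exp (η * Y ω)) ∂P with hM
  obtain ⟨K₁, hK₁, hb₁⟩ := exists_forall_one_le_lintegral_exp hY h₁
  obtain ⟨K₂, hK₂, hb₂⟩ := exists_forall_one_le_lintegral_exp hY.neg
    (by simpa [le_neg] using h₂)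
  obtain ⟨η, -, hmin⟩ := LowerSemicontinuousOn.exists_isMinOn (s := Set.Icc (-K₂) K₁)
    (f := M) ⟨0, by simp [hK₁, hK₂]⟩ isCompact_Icc
    ((lowerSemicontinuous_lintegral_exp hY).lowerSemicontinuousOn _)
  have hM0 : M 0 = 1 := by simp [hM]
  have hη1 : M η ≤ 1 := hM0 ▸ isMinOn_iff.mp hmin 0 (by simp [hK₁, hK₂])
  have hglob : ∀ t, M η ≤ M t := by
    intro t
    rcases le_or_gt K₁ t with h | h
    · exact hη1.trans (hb₁ t h)
    rcases le_or_gt t (-K₂) with h' | h'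
    · refine hη1.trans ((hb₂ (-t) (by linarith)).trans_eq ?_)
      simp [hM]
    · exact isMinOn_iff.mp hmin t ⟨h'.le, h.le⟩
  have hiff : ∀ t, t ∈ integrableExpSet Y P ↔ M t ≠ ∞ := fun t =>
    (lintegral_ofReal_ne_top_iff_integrable (by fun_prop)
      (ae_of_all _ fun _ => (Real.exp_pos _).le)).symm
  have hmem : η ∈ integrableExpSet Y P := (hiff η).mpr (hη1.trans_lt ENNReal.one_lt_top).ne
  have hint : η ∈ interior (integrableExpSet Y P) := by rwa [hopen.interior_eq]
  have hmM : ∀ t, mgf Y P t = (M t).toReal := fun t =>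
    integral_eq_lintegral_of_nonneg_ae (ae_of_all _ fun _ => (Real.exp_pos _).le) (by fun_prop)
  have hloc : IsLocalMin (mgf Y P) η := by
    filter_upwards [hopen.mem_nhds hmem] with t ht
    rw [hmM, hmM]
    exact ENNReal.toReal_mono ((hiff t).mp ht) (hglob t)
  have hd := hasDerivAt_mgf hint
  exact ⟨η, hint, hloc.hasDerivAt_eq_zero hd ▸ hd⟩

theorem integrableExpSet_sub_const (Y : Ω → ℝ) (x : ℝ) :
    integrableExpSet (fun ω => Y ω - x) P = integrableExpSet Y P := by
  ext t
  have h : (fun ω => Real.exp (t * (Y ω - x))) =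
      fun ω => Real.exp (t * Y ω) * Real.exp (-(t * x)) := by
    funext ω; rw [← Real.exp_add]; ring_nf
  change Integrable _ P ↔ Integrable _ P
  rw [h]
  exact integrable_mul_const_iff (Real.exp_pos _).ne'.isUnit _

/-- **Cramér's theorem** for symmetric real variables that are unbounded and whose exponential
moments are finite exactly on an open set. -/
theorem satisfiesLDP_legendreTransform [IsProbabilityMeasure P] {X : ℕ → Ω → ℝ} (hX : iIndepFun X P)
    (hid : ∀ i, IdentDistrib (X i) (X 0) P P) (hsymm : IdentDistrib (X 0) (fun ω => -X 0 ω) P P)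
    (hunb : ∀ M : ℝ, P {ω | M ≤ X 0 ω} ≠ 0) (hopen : IsOpen (integrableExpSet (X 0) P)) :
    SatisfiesLDP P (empiricalMean X) (fun n => (n : ℝ))
      (legendreTransform (freeEnergy P (X 0))) := by
  have hm := hsymm.aemeasurable_fst
  refine satisfiesLDP_of_eventually_bounds ?_ (legendreTransform_nonneg freeEnergy_zero)
    (lowerSemicontinuous_legendreTransform fun η => freeEnergy_ne_bot hm)
    (legendreTransform_abs (freeEnergy_neg hsymm))
    (fun a ha c hc => eventually_measureReal_le_abs_empiricalMean hX hid hsymm ha hc)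
    fun x δ hδ c hc => ?_
  · filter_upwards [eventually_gt_atTop 0] with n hn
    exact_mod_cast hn
  have hlow : P {ω | X 0 ω - x ≤ -1} ≠ 0 := by
    have h := hsymm.measure_mem_eq (measurableSet_Ici (a := 1 - x))
    refine fun h0 => hunb (1 - x) (h.trans ?_)
    rw [← h0]
    congr 1
    ext ω
    simp only [Set.mem_preimage, Set.mem_Ici, Set.mem_ofPred_eq]
    constructor <;> intro <;> linarith
  obtain ⟨η, hη, hd⟩ := exists_hasDerivAt_mgf_zero (Y := fun ω => X 0 ω - x) (hm.sub_const x)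
    (by simpa [le_sub_iff_add_le] using hunb (1 + x)) hlow
    (by rwa [integrableExpSet_sub_const])
  have hηX : Integrable (fun ω => Real.exp (η * X 0 ω)) P := by
    rw [integrableExpSet_sub_const] at hη
    exact interior_subset (s := integrableExpSet (X 0) P) hη
  -- Centring at x turns the negative log moment at `η` into `η * x - λ(η)`. This is one term of the
  -- supremum, hence below `c`; its optimality is not required.
  have hcgf : -cgf (fun ω => X 0 ω - x) P η < c := by
    have h : ((η * x : ℝ) : EReal) - freeEnergy P (X 0) η < c :=
      (le_iSup (fun η : ℝ => ((η * x : ℝ) : EReal) - freeEnergy P (X 0) η) η).trans_lt hc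
    rw [freeEnergy_eq_cgf hηX, ← EReal.coe_sub, EReal.coe_lt_coe_iff] at h
    have hmgf : mgf (fun ω => X 0 ω - x) P η = mgf (X 0) P η * Real.exp (η * -x) := by
      simp_rw [sub_eq_add_neg, mgf_add_const]
    rw [cgf, hmgf, Real.log_mul (mgf_pos hηX).ne' (Real.exp_pos _).ne', Real.log_exp]
    rw [cgf] at h
    linarith
  have hmain := eventually_le_measureReal_abs_sum_lt (X := fun i ω => X i ω - x)
    (hX.comp (fun _ y => y - x) fun _ => measurable_sub_const x)
    (fun i => (hid i).comp (measurable_sub_const x)) hη hd hδ hcgf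
  filter_upwards [hmain, eventually_gt_atTop 0] with n hn hn0
  refine hn.trans_eq ?_
  congr 1
  ext ω
  simp only [Set.mem_ofPred_eq, abs_empiricalMean_sub_lt_iff hn0, Finset.sum_sub_distrib,
    Finset.sum_const, Finset.card_range, nsmul_eq_mul]

end Cramer

/-! ### Stretched exponential tails and the single big jump -/

section StretchedExponential

/-- Follows from (1 - y) exp(y) ≤ 1. Only the positive part of y enters the exponential weight, so a
one-sided truncation is enough to control it. -/
theorem exp_le_one_add_self_add_sq_mul_exp (y : ℝ) :
    Real.exp y ≤ 1 + y + y ^ 2 * Real.exp (max y 0) := by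
  have h1 : (1 - y) * Real.exp y ≤ 1 := by
    have h := mul_le_mul_of_nonneg_right (Real.one_sub_le_exp_neg y) (Real.exp_pos y).le
    rwa [← Real.exp_add, neg_add_cancel, Real.exp_zero] at h
  rcases le_total 0 y with hy | hy
  · rw [max_eq_left hy]
    nlinarith [mul_le_mul_of_nonneg_left (by linarith : Real.exp y - 1 ≤ y * Real.exp y) hy]
  · rw [max_eq_right hy, Real.exp_zero, mul_one]
    nlinarith [Real.add_one_le_exp y]

theorem exists_sq_le_mul_exp_rpow {α ε : ℝ} (hα : 0 < α) (hε : 0 < ε) :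
    ∃ C : ℝ, ∀ y : ℝ, 0 ≤ y → y ^ 2 ≤ C * Real.exp (ε * y ^ α) := by
  -- Chosen so that log(ky) ≤ (ky)^α/α reads log(ky) ≤ εy^α/2.
  set k : ℝ := (ε * α / 2) ^ (1 / α) with hk
  have hkpos : 0 < k := by positivity
  have hkα : k ^ α = ε * α / 2 := by
    rw [hk, ← Real.rpow_mul (by positivity), one_div_mul_cancel hα.ne', Real.rpow_one]
  refine ⟨Real.exp (-2 * Real.log k), fun y hy => ?_⟩
  rcases hy.eq_or_lt with rfl | hy
  · simp only [ne_eq, OfNat.ofNat_ne_zero, not_false_eq_true, zero_pow]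
    positivity
  have h := Real.log_le_rpow_div (mul_pos hkpos hy).le hα
  rw [Real.log_mul hkpos.ne' hy.ne', Real.mul_rpow hkpos.le hy.le, hkα] at h
  have h' : ε * α / 2 * y ^ α / α = ε * y ^ α / 2 := by field_simp
  rw [h'] at h
  rw [← Real.exp_add]
  calc y ^ 2 = Real.exp (2 * Real.log y) := by
        rw [mul_comm, Real.exp_mul, Real.exp_log hy]; norm_num
    _ ≤ _ := Real.exp_le_exp.mpr (by linarith)

/-- Below the level `L`, the line through the origin and `(L, s L ^ α)` lies under the concave
function `s x ^ α`. -/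
theorem mul_min_le_mul_abs_rpow {α s L : ℝ} (hα : α ≤ 1) (hα0 : 0 < α) (hs : 0 ≤ s) (hL : 0 < L)
    (x : ℝ) : max (s * L ^ α / L * min x L) 0 ≤ s * |x| ^ α := by
  have h0 : 0 ≤ s * |x| ^ α := by positivity
  refine max_le ?_ h0
  rcases le_total x 0 with hx | hx
  · refine le_trans (mul_nonpos_of_nonneg_of_nonpos (by positivity) ?_) h0
    exact (min_le_left _ _).trans hx
  set w := min x L with hw
  have hw0 : 0 ≤ w := le_min hx hL.le
  have hwL : w / L ≤ 1 := (div_le_one hL).mpr (min_le_right _ _)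
  calc s * L ^ α / L * w = s * L ^ α * (w / L) := by ring
    _ ≤ s * L ^ α * (w / L) ^ α := by
        gcongr
        exact Real.self_le_rpow_of_le_one (by positivity) hwL hα
    _ = s * w ^ α := by
        rw [Real.div_rpow hw0 hL.le]; field_simp
    _ ≤ s * |x| ^ α := by
        rw [abs_of_nonneg hx]
        gcongr
        exact min_le_left _ _

variable {Ω : Type*} [MeasurableSpace Ω] {P : Measure Ω} {α : ℝ}

/-- The room between `s` and some `s' < 1 / 2` absorbs the square. -/
theorem integrable_sq_mul_exp_abs_rpow {Y : Ω → ℝ} (hα : 0 < α) (hY : AEMeasurable Y P)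
    (hexp : ∀ s < 1 / 2, Integrable (fun ω => Real.exp (s * |Y ω| ^ α)) P) {s : ℝ}
    (hs : s < 1 / 2) : Integrable (fun ω => Y ω ^ 2 * Real.exp (s * |Y ω| ^ α)) P := by
  obtain ⟨s', hs', hs'2⟩ := exists_between hs
  obtain ⟨C, hC⟩ := exists_sq_le_mul_exp_rpow hα (sub_pos.mpr hs')
  refine ((hexp s' hs'2).const_mul C).mono' (AEMeasurable.aestronglyMeasurable (by fun_prop))
    (ae_of_all _ fun ω => ?_)
  rw [Real.norm_of_nonneg (by positivity)]
  have h := mul_le_mul_of_nonneg_right (hC |Y ω| (abs_nonneg _)) (Real.exp_pos (s * |Y ω| ^ α)).le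
  rw [sq_abs, mul_assoc, ← Real.exp_add] at h
  refine h.trans_eq ?_
  ring_nf

theorem memLp_two_of_integrable_exp_abs_rpow {Y : Ω → ℝ} (hα : 0 < α) (hY : AEMeasurable Y P)
    (hexp : ∀ s < 1 / 2, Integrable (fun ω => Real.exp (s * |Y ω| ^ α)) P) : MemLp Y 2 P := by
  rw [memLp_two_iff_integrable_sq hY.aestronglyMeasurable]
  simpa using integrable_sq_mul_exp_abs_rpow hα hY hexp (by norm_num : (0 : ℝ) < 1 / 2)

theorem integral_eq_zero_of_identDistrib_neg {Y : Ω → ℝ}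
    (h : IdentDistrib Y (fun ω => -Y ω) P P) : ∫ ω, Y ω ∂P = 0 := by
  have h1 := h.integral_eq
  rw [integral_neg] at h1
  linarith

/-- Exponential moment of a truncated centered variable with stretched exponential moments. -/
theorem mgf_min_le_exp [IsProbabilityMeasure P] {Y : Ω → ℝ} (hα : 0 < α) (hα1 : α ≤ 1)
    (hY : AEMeasurable Y P) (hmean : ∫ ω, Y ω ∂P = 0)
    (hexp : ∀ s < 1 / 2, Integrable (fun ω => Real.exp (s * |Y ω| ^ α)) P) {s L : ℝ}
    (hs0 : 0 ≤ s) (hs : s < 1 / 2) (hL : 0 < L) :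
    Integrable (fun ω => Real.exp (s * L ^ α / L * min (Y ω) L)) P ∧
    mgf (fun ω => min (Y ω) L) P (s * L ^ α / L) ≤
      Real.exp ((s * L ^ α / L) ^ 2 * ∫ ω, Y ω ^ 2 * Real.exp (s * |Y ω| ^ α) ∂P) := by
  set η := s * L ^ α / L with hη
  have hη0 : 0 ≤ η := by positivity
  have hYi : Integrable Y P :=
    (memLp_two_of_integrable_exp_abs_rpow hα hY hexp).integrable (by norm_num)
  have hpt := fun ω => mul_min_le_mul_abs_rpow hα1 hα hs0 hL (Y ω)
  have hWi : Integrable (fun ω => min (Y ω) L) P := hYi.inf (integrable_const L)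
  have hint : Integrable (fun ω => Real.exp (η * min (Y ω) L)) P := by
    refine (hexp s hs).mono' (AEMeasurable.aestronglyMeasurable (by fun_prop))
      (ae_of_all _ fun ω => ?_)
    rw [Real.norm_of_nonneg (Real.exp_pos _).le]
    exact Real.exp_le_exp.mpr ((le_max_left _ _).trans (hpt ω))
  refine ⟨hint, ?_⟩
  have hC := integrable_sq_mul_exp_abs_rpow hα hY hexp hs
  -- This constant does not depend on the truncation level `L`.
  set C := ∫ ω, Y ω ^ 2 * Real.exp (s * |Y ω| ^ α) ∂P
  have i1 : Integrable (fun ω => 1 + η * min (Y ω) L) P :=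
    (integrable_const 1).add (hWi.const_mul η)
  calc mgf (fun ω => min (Y ω) L) P η
      ≤ ∫ ω, ((1 + η * min (Y ω) L) + η ^ 2 * (Y ω ^ 2 * Real.exp (s * |Y ω| ^ α))) ∂P := by
        refine integral_mono hint (i1.add (hC.const_mul _)) fun ω => ?_
        refine (exp_le_one_add_self_add_sq_mul_exp _).trans ?_
        have habs : (min (Y ω) L) ^ 2 ≤ Y ω ^ 2 := by
          rcases le_total (Y ω) L with h | h
          · rw [min_eq_left h]
          · rw [min_eq_right h]; gcongr
        have hexp' := Real.exp_le_exp.mpr (hpt ω)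
        have : (η * min (Y ω) L) ^ 2 * Real.exp (max (η * min (Y ω) L) 0) ≤
            η ^ 2 * (Y ω ^ 2 * Real.exp (s * |Y ω| ^ α)) := by
          rw [mul_pow, mul_assoc]
          gcongr
        simpa using this
    _ = 1 + η * ∫ ω, min (Y ω) L ∂P + η ^ 2 * C := by
        rw [integral_add i1 (hC.const_mul _), integral_add (integrable_const 1) (hWi.const_mul η),
          integral_const_mul, integral_const_mul, integral_const, probReal_univ, one_smul]
    _ ≤ 1 + η ^ 2 * C := by
        -- Truncating from above only lowers the mean, so the first-order term is nonpositive.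
        have : ∫ ω, min (Y ω) L ∂P ≤ 0 :=
          (integral_mono hWi hYi fun ω => min_le_left _ _).trans_eq hmean
        nlinarith
    _ ≤ Real.exp (η ^ 2 * C) := by linarith [Real.add_one_le_exp (η ^ 2 * C)]

/-- Absorbs the factor n of a union bound over the summands. -/
theorem eventually_natCast_mul_exp_le_exp {K b c : ℝ} (hbc : c < b) (hα : 0 < α) :
    ∀ᶠ n : ℕ in atTop,
      n * (K * Real.exp (-b * (n : ℝ) ^ α)) ≤ Real.exp (-c * (n : ℝ) ^ α) := by
  have hv : Tendsto (fun n : ℕ => (n : ℝ) ^ α) atTop atTop :=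
    (tendsto_rpow_atTop hα).comp tendsto_natCast_atTop_atTop
  have h := (tendsto_exp_mul_div_rpow_atTop (1 / α) (b - c) (sub_pos.mpr hbc)).comp hv
  filter_upwards [h.eventually_ge_atTop K, eventually_gt_atTop 0] with n hn hn0
  have hn' : (0 : ℝ) < n := by exact_mod_cast hn0
  simp only [Function.comp_apply] at hn
  rw [← Real.rpow_mul hn'.le, mul_one_div_cancel hα.ne', Real.rpow_one, le_div_iff₀ hn'] at hn
  calc n * (K * Real.exp (-b * (n : ℝ) ^ α)) = K * n * Real.exp (-b * (n : ℝ) ^ α) := by ring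
    _ ≤ Real.exp ((b - c) * (n : ℝ) ^ α) * Real.exp (-b * (n : ℝ) ^ α) := by gcongr
    _ = _ := by rw [← Real.exp_add]; ring_nf

variable {X : ℕ → Ω → ℝ}

/-- Upper tail of sums of centered variables with stretched exponential moments. -/
theorem eventually_measureReal_le_sum_range [IsProbabilityMeasure P] (hα : 0 < α) (hα1 : α < 1)
    (hX : iIndepFun X P) (hid : ∀ i, IdentDistrib (X i) (X 0) P P) (hmean : ∫ ω, X 0 ω ∂P = 0)
    (hexp : ∀ s < 1 / 2, Integrable (fun ω => Real.exp (s * |X 0 ω| ^ α)) P)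
    {a c : ℝ} (ha : 0 < a) (hc : c < a ^ α / 2) :
    ∀ᶠ n : ℕ in atTop, P.real {ω | n * a ≤ ∑ i ∈ Finset.range n, X i ω} ≤
      2 * Real.exp (-c * (n : ℝ) ^ α) := by
  have hY : AEMeasurable (X 0) P := (hid 0).aemeasurable_fst
  have haα : 0 < a ^ α := by positivity
  -- Any such `s` has `s * a ^ α > c`; the maximum with 0 keeps it nonnegative when `c` is negative.
  obtain ⟨s, hs1, hs2⟩ := exists_between (a₁ := max (c / a ^ α) 0) (a₂ := (1 / 2 : ℝ))
    (max_lt (by rw [div_lt_iff₀ haα]; linarith) (by norm_num))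
  have hs0 : 0 ≤ s := (le_max_right _ _).trans hs1.le
  have hsc : c < s * a ^ α := (div_lt_iff₀ haα).mp ((le_max_left _ _).trans_lt hs1)
  set C := ∫ ω, X 0 ω ^ 2 * Real.exp (s * |X 0 ω| ^ α) ∂P with hC
  -- With L = na and η = sL^α/L, the second-order cost nη²C equals n^α times this sequence, which
  -- vanishes because α < 1.
  have hdecay : Tendsto (fun n : ℕ => s ^ 2 * (a ^ α / a) ^ 2 * C * (n : ℝ) ^ (α - 1)) atTop
      (𝓝 (s ^ 2 * (a ^ α / a) ^ 2 * C * 0)) := by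
    refine Tendsto.const_mul _ ?_
    have := (tendsto_rpow_neg_atTop (sub_pos.mpr hα1)).comp
      (tendsto_natCast_atTop_atTop (R := ℝ))
    simpa [Function.comp_def] using this
  rw [mul_zero] at hdecay
  filter_upwards [hdecay.eventually (gt_mem_nhds (sub_pos.mpr hsc)),
    eventually_natCast_mul_exp_le_exp (K := ∫ ω, Real.exp (s * |X 0 ω| ^ α) ∂P) hsc hα,
    eventually_gt_atTop 0] with n hn1 hn2 hn0
  have hn' : (0 : ℝ) < n := by exact_mod_cast hn0
  set L : ℝ := n * a with hL
  have hLpos : 0 < L := by positivity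
  have hLα : L ^ α = n ^ α * a ^ α := Real.mul_rpow hn'.le ha.le
  have hjump : ∀ i, P.real {ω | L ≤ X i ω} ≤
      (∫ ω, Real.exp (s * |X 0 ω| ^ α) ∂P) * Real.exp (-(s * a ^ α) * (n : ℝ) ^ α) := by
    intro i
    have e : P.real {ω | L ≤ X i ω} = P.real {ω | L ≤ X 0 ω} :=
      congrArg ENNReal.toReal ((hid i).measure_mem_eq (measurableSet_Ici (a := L)))
    rw [e]
    have hmk := mul_meas_ge_le_integral_of_nonneg (ae_of_all P fun ω =>
      (Real.exp_pos (s * |X 0 ω| ^ α)).le) (hexp s hs2) (Real.exp (s * L ^ α))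
    have hsub : P.real {ω | L ≤ X 0 ω} ≤
        P.real {ω | Real.exp (s * L ^ α) ≤ Real.exp (s * |X 0 ω| ^ α)} := by
      refine measureReal_mono (fun ω hω => ?_) (measure_ne_top _ _)
      simp only [Set.mem_ofPred_eq] at hω ⊢
      have : L ≤ |X 0 ω| := hω.trans (le_abs_self _)
      gcongr
    have hE : Real.exp (-(s * a ^ α) * (n : ℝ) ^ α) = (Real.exp (s * L ^ α))⁻¹ := by
      rw [← Real.exp_neg, hLα]; ring_nf
    rw [hE, ← div_eq_mul_inv, le_div_iff₀ (Real.exp_pos _), mul_comm]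
    exact le_trans (by gcongr) hmk
  obtain ⟨hWint, hWmgf⟩ := mgf_min_le_exp hα hα1.le hY hmean hexp hs0 hs2 hLpos
  set η := s * L ^ α / L with hη
  have hη0 : 0 ≤ η := by positivity
  have hmin : Measurable fun x : ℝ => min x L := by fun_prop
  have hW := measureReal_le_sum_range_le (X := fun i ω => min (X i ω) L)
    (hX.comp (fun _ x => min x L) fun _ => hmin) (fun i => (hid i).comp hmin) hη0 hWint L n
  have hW2 : P.real {ω | L ≤ ∑ i ∈ Finset.range n, min (X i ω) L} ≤
      Real.exp (-c * (n : ℝ) ^ α) := by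
    refine hW.trans ?_
    calc Real.exp (-η * L) * mgf (fun ω => min (X 0 ω) L) P η ^ n
        ≤ Real.exp (-η * L) * Real.exp (η ^ 2 * C) ^ n := by
          gcongr
          exact mgf_nonneg
      _ = Real.exp (-(s * a ^ α - s ^ 2 * (a ^ α / a) ^ 2 * C * (n : ℝ) ^ (α - 1)) *
            (n : ℝ) ^ α) := by
          rw [← Real.exp_nat_mul, ← Real.exp_add]
          congr 1
          rw [hη, hLα, Real.rpow_sub_one hn'.ne', hL]
          field_simp
          ring
      _ ≤ _ := by
          refine Real.exp_le_exp.mpr ?_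
          have : (0 : ℝ) ≤ (n : ℝ) ^ α := by positivity
          nlinarith
  calc P.real {ω | L ≤ ∑ i ∈ Finset.range n, X i ω}
      ≤ P.real ((⋃ i ∈ Finset.range n, {ω | L ≤ X i ω}) ∪
          {ω | L ≤ ∑ i ∈ Finset.range n, min (X i ω) L}) := by
        refine measureReal_mono (fun ω hω => ?_) (measure_ne_top _ _)
        -- If no summand reaches `L`, truncation leaves the sum unchanged.
        by_cases h : ∃ i ∈ Finset.range n, L ≤ X i ω
        · obtain ⟨i, hi, hi'⟩ := h
          exact Or.inl (Set.mem_biUnion hi hi')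
        · push Not at h
          refine Or.inr ?_
          simp only [Set.mem_ofPred_eq] at hω ⊢
          rwa [Finset.sum_congr rfl fun i hi => min_eq_left (h i hi).le]
    _ ≤ P.real (⋃ i ∈ Finset.range n, {ω | L ≤ X i ω}) +
          P.real {ω | L ≤ ∑ i ∈ Finset.range n, min (X i ω) L} := measureReal_union_le _ _
    _ ≤ Real.exp (-c * (n : ℝ) ^ α) + Real.exp (-c * (n : ℝ) ^ α) := by
        refine add_le_add ?_ hW2
        refine (measureReal_biUnion_finset_le _ _).trans ((Finset.sum_le_card_nsmul _ _ _
          fun i _ => hjump i).trans ?_)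
        simpa using hn2
    _ = _ := by ring

/-- A sum is near `n * x` if one term is near `n * x` and the other terms have a small sum. -/
theorem eventually_half_mul_measureReal_le [IsProbabilityMeasure P] (hX : iIndepFun X P)
    (hid : ∀ i, IdentDistrib (X i) (X 0) P P) (hmean : ∫ ω, X 0 ω ∂P = 0)
    (hL2 : MemLp (X 0) 2 P) (x : ℝ) {δ : ℝ} (hδ : 0 < δ) :
    ∀ᶠ n : ℕ in atTop, 1 / 2 * P.real {ω | |X 0 ω - n * x| < n * (δ / 2)} ≤
      P.real {ω | |∑ i ∈ Finset.range n, X i ω - n * x| < n * δ} := by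
  set V := variance (X 0) P with hV
  have hlim : Tendsto (fun n : ℕ => V / (δ / 2) ^ 2 / (n : ℝ)) atTop (𝓝 0) :=
    tendsto_const_div_atTop_nhds_zero_nat _
  filter_upwards [hlim.eventually (gt_mem_nhds (by norm_num : (0 : ℝ) < 1 / 2)),
    eventually_gt_atTop 0] with n hn hn0
  have hn' : (0 : ℝ) < n := by exact_mod_cast hn0
  -- The last summand `X m` carries the jump and the first `m` form `T`; each is allowed half of the
  -- window.
  obtain ⟨m, rfl⟩ : ∃ m, n = m + 1 := ⟨n - 1, by omega⟩
  set r : ℝ := ((m + 1 : ℕ) : ℝ) * (δ / 2) with hr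
  have hrpos : 0 < r := by positivity
  set T : Ω → ℝ := ∑ i ∈ Finset.range m, X i with hT
  have hL2i : ∀ i, MemLp (X i) 2 P := fun i => (hid i).symm.memLp_snd hL2
  have hTL2 : MemLp T 2 P := memLp_finsetSum' _ fun i _ => hL2i i
  have hTmean : ∫ ω, T ω ∂P = 0 := by
    simp only [hT, Finset.sum_apply]
    rw [integral_finsetSum _ fun i _ => (hL2i i).integrable (by norm_num)]
    exact Finset.sum_eq_zero fun i _ => (hid i).integral_eq.trans hmean
  have hTvar : variance T P = m * V := by
    rw [hT, IndepFun.variance_sum (fun i _ => hL2i i) fun i _ j _ hij => hX.indepFun hij]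
    simp [fun i => (hid i).variance_eq, hV]
  have hcheb : P.real {ω | r ≤ |T ω|} ≤ 1 / 2 := by
    have h := meas_ge_le_variance_div_sq hTL2 hrpos
    simp only [hTmean, sub_zero] at h
    refine ENNReal.toReal_le_of_le_ofReal (by norm_num) (h.trans (ENNReal.ofReal_le_ofReal ?_))
    refine le_trans ?_ hn.le
    rw [hTvar, hr, mul_pow, div_div, div_le_div_iff₀ (by positivity) (by positivity)]
    have hV0 : 0 ≤ V := variance_nonneg _ _
    have : (m : ℝ) ≤ ((m + 1 : ℕ) : ℝ) := by push_cast; linarith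
    calc m * V * ((δ / 2) ^ 2 * ((m + 1 : ℕ) : ℝ))
        ≤ ((m + 1 : ℕ) : ℝ) * V * ((δ / 2) ^ 2 * ((m + 1 : ℕ) : ℝ)) := by gcongr
      _ = _ := by ring
  have hTm : AEMeasurable T P := hTL2.aestronglyMeasurable.aemeasurable
  have hsmall : 1 / 2 ≤ P.real {ω | |T ω| < r} := by
    have h1 : (1 : ℝ) ≤ P.real {ω | r ≤ |T ω|} + P.real {ω | |T ω| < r} := by
      refine le_trans (le_of_eq ?_) (measureReal_union_le _ _)
      rw [← probReal_univ (μ := P)]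
      congr 1
      ext ω
      simp [le_or_gt]
    linarith
  have hind : IndepFun T (X m) P :=
    hX.indepFun_finsetSum_of_notMem₀ (fun i => (hid i).aemeasurable_fst) (by simp)
  have hmul := hind.measure_inter_preimage_eq_mul {y | |y| < r}
    {y | |y - (m + 1 : ℕ) * x| < r} (measurableSet_lt (by fun_prop) (by fun_prop))
    (measurableSet_lt (by fun_prop) (by fun_prop))
  have hXm : P (X m ⁻¹' {y | |y - (m + 1 : ℕ) * x| < r}) =
      P {ω | |X 0 ω - (m + 1 : ℕ) * x| < r} :=
    (hid m).measure_mem_eq (measurableSet_lt (by fun_prop) (by fun_prop))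
  rw [hXm] at hmul
  calc 1 / 2 * P.real {ω | |X 0 ω - (m + 1 : ℕ) * x| < r}
      ≤ P.real {ω | |T ω| < r} * P.real {ω | |X 0 ω - (m + 1 : ℕ) * x| < r} := by gcongr
    _ = P.real (T ⁻¹' {y | |y| < r} ∩ X m ⁻¹' {y | |y - (m + 1 : ℕ) * x| < r}) := by
        rw [measureReal_def, measureReal_def, measureReal_def, hmul, ENNReal.toReal_mul]
        rfl
    _ ≤ _ := by
        refine measureReal_mono (fun ω hω => ?_) (measure_ne_top _ _)
        simp only [Set.mem_inter_iff, Set.mem_preimage, Set.mem_ofPred_eq] at hω ⊢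
        rw [Finset.sum_range_succ]
        have hTω : ∑ i ∈ Finset.range m, X i ω = T ω := by simp [hT]
        rw [hTω, add_sub_assoc]
        refine (abs_add_le _ _).trans_lt ?_
        have : ((m + 1 : ℕ) : ℝ) * δ = r + r := by rw [hr]; ring
        linarith [hω.1, hω.2]

/-- Large deviations principle for symmetric variables with stretched exponential tails. -/
theorem satisfiesLDP_abs_rpow_div_two [IsProbabilityMeasure P] (hα : 0 < α) (hα1 : α < 1)
    (hX : iIndepFun X P) (hid : ∀ i, IdentDistrib (X i) (X 0) P P)
    (hsymm : IdentDistrib (X 0) (fun ω => -X 0 ω) P P)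
    (hexp : ∀ s < 1 / 2, Integrable (fun ω => Real.exp (s * |X 0 ω| ^ α)) P)
    (hlow : ∀ x δ c : ℝ, 0 < δ → |x| ^ α / 2 < c → ∀ᶠ n : ℕ in atTop,
      Real.exp (-c * (n : ℝ) ^ α) ≤ P.real {ω | |X 0 ω - n * x| < n * δ}) :
    SatisfiesLDP P (empiricalMean X) (fun n => (n : ℝ) ^ α)
      (fun x => ((|x| ^ α / 2 : ℝ) : EReal)) := by
  have hmean := integral_eq_zero_of_identDistrib_neg hsymm
  have hv : Tendsto (fun n : ℕ => (n : ℝ) ^ α) atTop atTop :=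
    (tendsto_rpow_atTop hα).comp tendsto_natCast_atTop_atTop
  refine satisfiesLDP_of_eventually_bounds (hv.eventually_gt_atTop 0) (fun x => ?_) ?_
    (fun x => by rw [abs_abs]) (fun a ha c hc => ?_) fun x δ hδ c hc => ?_
  · exact_mod_cast (by positivity : (0 : ℝ) ≤ |x| ^ α / 2)
  · refine Continuous.lowerSemicontinuous (continuous_coe_real_ereal.comp ?_)
    exact (continuous_abs.rpow_const fun _ => Or.inr hα.le).div_const 2
  · rw [EReal.coe_lt_coe_iff, abs_of_nonneg ha] at hc
    rcases ha.eq_or_lt with rfl | ha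
    · rw [Real.zero_rpow hα.ne', zero_div] at hc
      -- For a = 0 the rate vanishes, so `c < 0` and the right-hand side is at least 1.
      refine Eventually.of_forall fun n => measureReal_le_one.trans (Real.one_le_exp ?_)
      have : (0 : ℝ) ≤ (n : ℝ) ^ α := by positivity
      nlinarith
    obtain ⟨b, hcb, hb⟩ := exists_between hc
    have hneg : ∀ s < 1 / 2, Integrable (fun ω => Real.exp (s * |-X 0 ω| ^ α)) P := by
      simpa only [abs_neg] using hexp
    filter_upwards [eventually_measureReal_le_sum_range hα hα1 hX hid hmean hexp ha hb,
      eventually_measureReal_le_sum_range (X := fun i ω => -X i ω) hα hα1 (iIndepFun_neg hX)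
        (identDistrib_neg_zero hid) (by rw [integral_neg, hmean, neg_zero]) hneg ha hb,
      -- The factor 4 comes from two tails, each with a jump term and a truncated term.
      eventually_mul_exp_le_exp (K := 4) hcb hv, eventually_gt_atTop 0] with n h1 h2 h3 hn0
    refine (measureReal_le_abs_empiricalMean_le hn0 h1 h2).trans (le_trans (le_of_eq ?_) h3)
    ring
  · rw [EReal.coe_lt_coe_iff] at hc
    obtain ⟨b, hb, hbc⟩ := exists_between hc
    filter_upwards [hlow x (δ / 2) b (half_pos hδ) hb, eventually_half_mul_measureReal_le hX hid
      hmean (memLp_two_of_integrable_exp_abs_rpow hα hsymm.aemeasurable_fst hexp) x hδ,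
      eventually_mul_exp_le_exp (K := 2) hbc hv, eventually_gt_atTop 0] with n h1 h2 h3 hn0
    simp only [abs_empiricalMean_sub_lt_iff hn0]
    linarith

end StretchedExponential

/-! ### Signed powers of a standard Gaussian -/

section Gaussian

theorem signedPow_neg (p x : ℝ) : signedPow p (-x) = -signedPow p x := by
  simp [signedPow, Real.sign_neg]

theorem signedPow_of_pos (p : ℝ) {x : ℝ} (hx : 0 < x) : signedPow p x = x ^ p := by
  rw [signedPow, Real.sign_of_pos hx, one_mul, abs_of_pos hx]

theorem abs_signedPow {p : ℝ} (hp : p ≠ 0) (x : ℝ) : |signedPow p x| = |x| ^ p := by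
  rcases lt_trichotomy x 0 with hx | rfl | hx
  · rw [← abs_neg, ← signedPow_neg, signedPow_of_pos p (neg_pos.mpr hx), abs_of_neg hx]
    exact abs_of_nonneg (by have := neg_pos.mpr hx; positivity)
  · simp [signedPow, Real.zero_rpow hp]
  · rw [signedPow_of_pos p hx, abs_of_pos hx, abs_of_pos (by positivity)]

theorem measurable_signedPow (p : ℝ) : Measurable (signedPow p) := by
  have hs : Measurable Real.sign := by
    unfold Real.sign
    exact Measurable.ite measurableSet_Iio measurable_const
      (Measurable.ite measurableSet_Ioi measurable_const measurable_const)
  unfold signedPow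
  fun_prop

/-- Against the Gaussian density there remains exp(-(1/2 - s)x²). Failure at s = 1/2 itself is what
makes the domain open when p = 2. -/
theorem integrable_exp_mul_sq_gaussianReal_iff {s : ℝ} :
    Integrable (fun x : ℝ => Real.exp (s * x ^ 2)) (gaussianReal 0 1) ↔ s < 1 / 2 := by
  rw [gaussianReal_of_var_ne_zero _ one_ne_zero, integrable_withDensity_iff
    (measurable_gaussianPDF 0 1) (ae_of_all _ fun _ => gaussianPDF_lt_top)]
  have h : (fun x : ℝ => Real.exp (s * x ^ 2) * (gaussianPDF 0 1 x).toReal) =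
      fun x => (√(2 * Real.pi))⁻¹ * Real.exp (-(1 / 2 - s) * x ^ 2) := by
    funext x
    rw [toReal_gaussianPDF, gaussianPDFReal]
    simp only [NNReal.coe_one, mul_one, sub_zero]
    rw [mul_left_comm, ← Real.exp_add]
    ring_nf
  rw [h, integrable_const_mul_iff (by positivity : (√(2 * Real.pi))⁻¹ ≠ 0).isUnit,
    integrable_exp_neg_mul_sq_iff, sub_pos]

theorem identDistrib_signedPow_neg (p : ℝ) :
    IdentDistrib (signedPow p) (fun x => -signedPow p x) (gaussianReal 0 1) (gaussianReal 0 1) := by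
  have h : IdentDistrib (fun x : ℝ => x) (fun x => -x) (gaussianReal 0 1) (gaussianReal 0 1) :=
    ⟨by fun_prop, by fun_prop, by
      rw [gaussianReal_map_neg, neg_zero]; exact Measure.map_id⟩
  have h2 := h.comp (measurable_signedPow p)
  have e : (signedPow p ∘ fun x : ℝ => -x) = fun x => -signedPow p x :=
    funext fun x => signedPow_neg p x
  rw [e] at h2
  exact h2

theorem gaussianReal_le_signedPow_ne_zero {p : ℝ} (hp : 0 < p) (M : ℝ) :
    gaussianReal 0 1 {x | M ≤ signedPow p x} ≠ 0 := by
  intro h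
  have h0 := gaussianReal_absolutelyContinuous' 0 one_ne_zero h
  have hsub : Set.Ioi (max M 1 ^ (1 / p)) ⊆ {x | M ≤ signedPow p x} := by
    intro x hx
    have hM : (0 : ℝ) < max M 1 := lt_max_of_lt_right one_pos
    have hx' : max M 1 ^ (1 / p) < x := hx
    have hx0 : 0 < x := lt_trans (by positivity) hx'
    rw [Set.mem_ofPred_eq, signedPow_of_pos p hx0]
    calc M ≤ max M 1 := le_max_left _ _
      _ = (max M 1 ^ (1 / p)) ^ p := by
          rw [← Real.rpow_mul hM.le, one_div_mul_cancel hp.ne', Real.rpow_one]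
      _ ≤ x ^ p := by gcongr
  have := measure_mono_null hsub h0
  simp at this

theorem exists_mul_rpow_le {p : ℝ} (hp : 0 < p) (hp2 : p < 2) (t : ℝ) :
    ∃ C : ℝ, ∀ y : ℝ, 0 ≤ y → |t| * y ^ p ≤ C + 1 / 4 * y ^ 2 := by
  have h : Tendsto (fun K : ℝ => |t| * K ^ (-(2 - p))) atTop (𝓝 (|t| * 0)) :=
    (tendsto_rpow_neg_atTop (sub_pos.mpr hp2)).const_mul _
  rw [mul_zero] at h
  -- Beyond `K` the ratio |t|y^p/y² is below 1/4; any constant below the Gaussian threshold 1/2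
  -- would serve.
  obtain ⟨K, hK, hK0⟩ := ((h.eventually (gt_mem_nhds (by norm_num : (0 : ℝ) < 1 / 4))).and
    (eventually_gt_atTop 0)).exists
  refine ⟨|t| * K ^ p, fun y hy => ?_⟩
  rcases le_total y K with hyK | hyK
  · have : |t| * y ^ p ≤ |t| * K ^ p := by gcongr
    nlinarith [sq_nonneg y]
  · have hy0 : 0 < y := hK0.trans_le hyK
    have e : y ^ p = y ^ (-(2 - p)) * y ^ 2 := by
      rw [← Real.rpow_natCast y 2, ← Real.rpow_add hy0]
      congr 1
      push_cast
      ring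
    have h1 : y ^ (-(2 - p)) ≤ K ^ (-(2 - p)) :=
      Real.rpow_le_rpow_of_nonpos hK0 hyK (by linarith)
    have h2 : |t| * y ^ p ≤ 1 / 4 * y ^ 2 := by
      rw [e, ← mul_assoc]
      gcongr
      exact le_trans (by gcongr) hK.le
    have : 0 ≤ |t| * K ^ p := by positivity
    linarith

theorem mul_signedPow_le {p : ℝ} (hp : p ≠ 0) (t x : ℝ) : t * signedPow p x ≤ |t| * |x| ^ p := by
  rw [← abs_signedPow hp, ← abs_mul]
  exact le_abs_self _

theorem isOpen_integrableExpSet_signedPow {p : ℝ} (hp : 0 < p) (hp2 : p ≤ 2) :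
    IsOpen (integrableExpSet (signedPow p) (gaussianReal 0 1)) := by
  have hm : ∀ t : ℝ, AEStronglyMeasurable (fun x => Real.exp (t * signedPow p x))
      (gaussianReal 0 1) := fun t =>
    (((measurable_signedPow p).const_mul t).exp).aestronglyMeasurable
  rcases hp2.lt_or_eq with hp2 | rfl
  · suffices h : integrableExpSet (signedPow p) (gaussianReal 0 1) = Set.univ by
      rw [h]; exact isOpen_univ
    refine Set.eq_univ_of_forall fun t => ?_
    obtain ⟨C, hC⟩ := exists_mul_rpow_le hp hp2 t
    have hi := (integrable_exp_mul_sq_gaussianReal_iff (s := 1 / 4)).mpr (by norm_num)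
    refine (hi.const_mul (Real.exp C)).mono' (hm t) (ae_of_all _ fun x => ?_)
    rw [Real.norm_of_nonneg (Real.exp_pos _).le, ← Real.exp_add, ← sq_abs x]
    exact Real.exp_le_exp.mpr ((mul_signedPow_le hp.ne' t x).trans (hC _ (abs_nonneg x)))
  · suffices h : integrableExpSet (signedPow 2) (gaussianReal 0 1) = {t | |t| < 1 / 2} by
      rw [h]; exact isOpen_lt continuous_abs continuous_const
    ext t
    rw [Set.mem_ofPred_eq, ← integrable_exp_mul_sq_gaussianReal_iff]
    refine ⟨fun ht => ?_, fun ht => ?_⟩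
    · have hu : Measurable fun x : ℝ => Real.exp (t * x) := by fun_prop
      have ht' := ((identDistrib_signedPow_neg 2).comp hu).integrable_snd ht
      refine (Integrable.add ht ht').mono' (by fun_prop) (ae_of_all _ fun x => ?_)
      rw [Real.norm_of_nonneg (Real.exp_pos _).le]
      have e : |t| * x ^ 2 = |t * signedPow 2 x| := by
        rw [abs_mul, abs_signedPow two_ne_zero, Real.rpow_two, sq_abs]
      rw [e]
      change _ ≤ Real.exp (t * signedPow 2 x) + Real.exp (t * -signedPow 2 x)
      have h1 := Real.exp_pos (t * signedPow 2 x)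
      have h2 := Real.exp_pos (t * -signedPow 2 x)
      rcases abs_choice (t * signedPow 2 x) with h | h <;> rw [h]
      · linarith
      · rw [← mul_neg]; linarith
    · refine ht.mono' (hm t) (ae_of_all _ fun x => ?_)
      rw [Real.norm_of_nonneg (Real.exp_pos _).le]
      refine Real.exp_le_exp.mpr ((mul_signedPow_le two_ne_zero t x).trans_eq ?_)
      rw [Real.rpow_two, sq_abs]

theorem integrable_exp_mul_abs_signedPow_rpow {p : ℝ} (hp : 0 < p) {s : ℝ} (hs : s < 1 / 2) :
    Integrable (fun x => Real.exp (s * |signedPow p x| ^ (2 / p))) (gaussianReal 0 1) := by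
  have e : ∀ x : ℝ, |signedPow p x| ^ (2 / p) = x ^ 2 := fun x => by
    rw [abs_signedPow hp.ne', ← Real.rpow_mul (abs_nonneg x), mul_div_cancel₀ _ hp.ne',
      Real.rpow_two, sq_abs]
  simp_rw [e]
  exact integrable_exp_mul_sq_gaussianReal_iff.mpr hs

theorem mul_exp_le_gaussianReal_Ioo {u v : ℝ} (hu : 0 ≤ u) (huv : u ≤ v) :
    (√(2 * Real.pi))⁻¹ * Real.exp (-v ^ 2 / 2) * (v - u) ≤
      (gaussianReal 0 1).real (Set.Ioo u v) := by
  rw [measureReal_def, gaussianReal_apply_eq_integral 0 one_ne_zero,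
    ENNReal.toReal_ofReal (integral_nonneg fun x => gaussianPDFReal_nonneg _ _ _)]
  have h := setIntegral_mono_on (μ := volume) (s := Set.Ioo u v)
    (f := fun _ => (√(2 * Real.pi))⁻¹ * Real.exp (-v ^ 2 / 2)) (g := gaussianPDFReal 0 1)
    (integrableOn_const (by simp)) (integrable_gaussianPDFReal 0 1).integrableOn measurableSet_Ioo
    fun x hx => by
      rw [gaussianPDFReal]
      simp only [NNReal.coe_one, mul_one, sub_zero]
      have : x ^ 2 ≤ v ^ 2 := pow_le_pow_left₀ (hu.trans hx.1.le) hx.2.le 2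
      gcongr
  refine le_trans (le_of_eq ?_) h
  rw [setIntegral_const, smul_eq_mul, Real.volume_real_Ioo_of_le huv, mul_comm]

/-- It suffices that G^p lies in (nx, n(x + d)), so that G lies in an interval with endpoints of
order n^(1/p). The density at the right endpoint gives the rate (x + d)^(2/p)/2, and d is taken
small enough to keep it below `c`. -/
theorem eventually_exp_le_gaussianReal_of_nonneg {p : ℝ} (hp : 0 < p) {x δ c : ℝ} (hx : 0 ≤ x)
    (hδ : 0 < δ) (hc : x ^ (2 / p) / 2 < c) :
    ∀ᶠ n : ℕ in atTop, Real.exp (-c * (n : ℝ) ^ (2 / p)) ≤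
      (gaussianReal 0 1).real {g | |signedPow p g - n * x| < n * δ} := by
  obtain ⟨d, hd0, hdδ, hdc⟩ : ∃ d, 0 < d ∧ d ≤ δ ∧ (x + d) ^ (2 / p) / 2 < c := by
    have hcont : Continuous fun d : ℝ => (x + d) ^ (2 / p) / 2 :=
      ((continuous_const.add continuous_id).rpow_const fun _ => Or.inr (by positivity)).div_const 2
    have h : Tendsto (fun d : ℝ => (x + d) ^ (2 / p) / 2) (𝓝[>] 0) (𝓝 ((x + 0) ^ (2 / p) / 2)) :=
      (hcont.tendsto 0).mono_left nhdsWithin_le_nhds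
    obtain ⟨d, hd1, hd2⟩ := ((h.eventually (gt_mem_nhds (by simpa using hc))).and
      (Ioc_mem_nhdsGT hδ)).exists
    exact ⟨d, hd2.1, hd2.2, hd1⟩
  set A : ℝ := x ^ (1 / p) with hA
  set B : ℝ := (x + d) ^ (1 / p) with hB
  have hAB : A < B := Real.rpow_lt_rpow hx (by linarith) (by positivity)
  have hA0 : 0 ≤ A := by positivity
  have hpow : ∀ y : ℝ, 0 ≤ y → (y ^ (1 / p)) ^ p = y := fun y hy => by
    rw [← Real.rpow_mul hy, one_div_mul_cancel hp.ne', Real.rpow_one]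
  have hpow2 : ∀ y : ℝ, 0 ≤ y → (y ^ (1 / p)) ^ 2 = y ^ (2 / p) := fun y hy => by
    rw [← Real.rpow_two, ← Real.rpow_mul hy]; ring_nf
  set κ : ℝ := (√(2 * Real.pi))⁻¹ * (B - A) with hκ
  have hκ0 : 0 < κ := mul_pos (by positivity) (sub_pos.mpr hAB)
  have hv : Tendsto (fun n : ℕ => (n : ℝ) ^ (2 / p)) atTop atTop :=
    (tendsto_rpow_atTop (by positivity)).comp tendsto_natCast_atTop_atTop
  filter_upwards [eventually_mul_exp_le_exp (K := κ⁻¹) hdc hv, eventually_ge_atTop 1] with n hn hn1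
  have hn1' : (1 : ℝ) ≤ n := by exact_mod_cast hn1
  have hn0 : (0 : ℝ) < n := by linarith
  set N : ℝ := (n : ℝ) ^ (1 / p) with hN
  have hN1 : 1 ≤ N := Real.one_le_rpow hn1' (by positivity)
  rw [inv_mul_le_iff₀ hκ0] at hn
  calc Real.exp (-c * (n : ℝ) ^ (2 / p))
      ≤ κ * Real.exp (-((x + d) ^ (2 / p) / 2) * (n : ℝ) ^ (2 / p)) := hn
    _ = (√(2 * Real.pi))⁻¹ * Real.exp (-(N * B) ^ 2 / 2) * (B - A) := by
        have e : (N * B) ^ 2 = (n : ℝ) ^ (2 / p) * (x + d) ^ (2 / p) := by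
          rw [mul_pow, hN, hB, hpow2 _ hn0.le, hpow2 _ (by linarith)]
        rw [e, hκ]
        ring_nf
    -- The interval has length N(B - A), and N ≥ 1.
    _ ≤ (√(2 * Real.pi))⁻¹ * Real.exp (-(N * B) ^ 2 / 2) * (N * B - N * A) := by
        exact mul_le_mul_of_nonneg_left (by nlinarith) (by positivity)
    _ ≤ (gaussianReal 0 1).real (Set.Ioo (N * A) (N * B)) :=
        mul_exp_le_gaussianReal_Ioo (by positivity) (by gcongr)
    _ ≤ _ := by
        refine measureReal_mono (fun g hg => ?_) (measure_ne_top _ _)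
        have hg0 : 0 < g := lt_of_le_of_lt (by positivity) hg.1
        have h1 := Real.rpow_lt_rpow (by positivity) hg.1 hp
        have h2 := Real.rpow_lt_rpow hg0.le hg.2 hp
        have hB0 : 0 ≤ B := hA0.trans hAB.le
        rw [Real.mul_rpow (by positivity) hA0, hN, hpow _ hn0.le, hA, hpow _ hx] at h1
        rw [Real.mul_rpow (by positivity) hB0, hN, hpow _ hn0.le, hB, hpow _ (by linarith)] at h2
        rw [Set.mem_ofPred_eq, signedPow_of_pos p hg0, abs_lt]
        have := mul_le_mul_of_nonneg_left hdδ hn0.le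
        constructor <;> nlinarith

theorem eventually_exp_le_gaussianReal {p : ℝ} (hp : 0 < p) {x δ c : ℝ}
    (hδ : 0 < δ) (hc : |x| ^ (2 / p) / 2 < c) :
    ∀ᶠ n : ℕ in atTop, Real.exp (-c * (n : ℝ) ^ (2 / p)) ≤
      (gaussianReal 0 1).real {g | |signedPow p g - n * x| < n * δ} := by
  rcases le_total 0 x with hx | hx
  · exact eventually_exp_le_gaussianReal_of_nonneg hp hx hδ (by rwa [abs_of_nonneg hx] at hc)
  · filter_upwards [eventually_exp_le_gaussianReal_of_nonneg hp (neg_nonneg.mpr hx) hδ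
      (by rwa [abs_of_nonpos hx] at hc)] with n hn
    refine hn.trans_eq ?_
    have h := (identDistrib_signedPow_neg p).measure_mem_eq (s := {y | |y - n * -x| < n * δ})
      (measurableSet_lt (by fun_prop) (by fun_prop))
    refine congrArg ENNReal.toReal (h.trans ?_)
    congr 1
    ext g
    simp only [Set.mem_preimage, Set.mem_ofPred_eq]
    rw [← abs_neg, neg_sub, sub_neg_eq_add, mul_neg, sub_eq_add_neg, add_comm, ← sub_eq_add_neg]

end Gaussian

/-! ### The two regimes for powers of a Gaussian -/

theorem proposition2 {Ω₀ Ω : Type*} [MeasurableSpace Ω₀] [MeasurableSpace Ω]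
    (P₀ : Measure Ω₀) [IsProbabilityMeasure P₀] (P : Measure Ω) [IsProbabilityMeasure P]
    (G : Ω₀ → ℝ) (hG : HasLaw G (gaussianReal 0 1) P₀)
    (p : ℝ) (Z : Ω₀ → ℝ) (hZ : Z = fun ω => signedPow p (G ω))
    (X : ℕ → Ω → ℝ) (hindep : iIndepFun X P) (hident : ∀ i, IdentDistrib (X i) Z P P₀) :
    (0 < p → p ≤ 2 →
      SatisfiesLDP P (empiricalMean X) (fun n => (n : ℝ))
        (legendreTransform (freeEnergy P₀ Z))) ∧
    (2 < p →
      SatisfiesLDP P (empiricalMean X) (fun n => (n : ℝ) ^ (2 / p))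
        (fun x => ((|x| ^ (2 / p) / 2 : ℝ) : EReal))) := by
  have hid : ∀ i, IdentDistrib (X i) (X 0) P P := fun i => (hident i).trans (hident 0).symm
  have hlaw : IdentDistrib (X 0) (signedPow p) P (gaussianReal 0 1) := by
    have hGid : IdentDistrib G (fun x : ℝ => x) P₀ (gaussianReal 0 1) :=
      ⟨hG.aemeasurable, by fun_prop, hG.map_eq.trans Measure.map_id.symm⟩
    have h := hGid.comp (measurable_signedPow p)
    refine (hident 0).trans ?_
    rw [hZ]
    exact h
  have hsymm : IdentDistrib (X 0) (fun ω => -X 0 ω) P P :=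
    (hlaw.trans (identDistrib_signedPow_neg p)).trans (hlaw.comp measurable_neg).symm
  refine ⟨fun hp hp2 => ?_, fun hp => ?_⟩
  · rw [← freeEnergy_congr_identDistrib (hident 0)]
    refine satisfiesLDP_legendreTransform hindep hid hsymm (fun M => ?_) ?_
    · have h := hlaw.measure_mem_eq (measurableSet_Ici (a := M))
      exact fun h0 => gaussianReal_le_signedPow_ne_zero hp M (h.symm.trans h0)
    · have h : integrableExpSet (X 0) P = integrableExpSet (signedPow p) (gaussianReal 0 1) := by
        ext t
        have hu : Measurable fun x : ℝ => Real.exp (t * x) := by fun_prop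
        exact (hlaw.comp hu).integrable_iff
      rw [h]
      exact isOpen_integrableExpSet_signedPow hp hp2
  · have hp0 : 0 < p := by linarith
    refine satisfiesLDP_abs_rpow_div_two (by positivity) ((div_lt_one hp0).mpr hp) hindep hid hsymm
      (fun s hs => ?_) fun x δ c hδ hc => ?_
    · have hu : Measurable fun x : ℝ => Real.exp (s * |x| ^ (2 / p)) := by fun_prop
      exact (hlaw.comp hu).integrable_iff.mpr (integrable_exp_mul_abs_signedPow_rpow hp0 hs)
    · filter_upwards [eventually_exp_le_gaussianReal hp0 hδ hc] with n hn
      refine hn.trans_eq (congrArg ENNReal.toReal ?_)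
      exact (hlaw.measure_mem_eq (s := {y | |y - n * x| < n * δ})
        (measurableSet_lt (by fun_prop) (by fun_prop))).symm
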